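/- There is an absolute constant $C>0$ such that the following holds. Let $d\ge 0$ and let $f:\mathbb{R}^d\to\mathbb{R}$ be differentiable and $\ell$-smooth with $\ell>0$, i.e. $\|\nabla f(x)-\nabla f(y)\|\le \ell\|x-y\|$ for all $x,y$. Let $g(x;\xi)$, with $\xi$ drawn from a probability distribution $D$, be a stochastic gradient of $f$ such that for every $x\in\mathbb{R}^d$, $\mathbb{E}_\xi\, g(x;\xi)=\nabla f(x)$ and $\mathbb{E}_\xi\|g(x;\xi)-\nabla f(x)\|^2\le\sigma^2$, where $\sigma\ge 0$. Let $x_0\in\mathbb{R}^d$ satisfy $f(x_0)-\inf_x f(x)\le\Delta<\infty$, and let $\xi_0,\xi_1,\dots$ be i.i.d. with law $D$. Run AdaGrad-norm with arbitrary $\eta>0$ and $v_0>0$: $$v_{t+1}^2=v_t^2+\|g(x_t;\xi_t)\|^2,\qquad x_{t+1}=x_t-\frac{\eta}{\sqrt{v_{t+1}^2}}\,g(x_t;\xi_t),\qquad t=0,1,2,\dots$$ Then $\mathbb{E}\|\nabla f(x_t)\|<\infty$ for every $t$, and for every integer $T\ge 1$ $$\frac1T\sum_{t=0}^{T-1}\mathbb{E}\|\nabla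 f(x_t)\|\le\frac{2A}{\sqrt T}+\frac{\sqrt{v_0A}}{\sqrt T}+\frac{2\sqrt{A\sigma}}{T^{1/4}},$$ where $A=C\,B\,\log\!\left(2+T+\frac{B}{v_0}\right)$ with $B=\frac{\Delta}{\eta}+\sigma+\ell\eta$; in particular $A=\widetilde{\mathcal O}\!\left(\frac{\Delta}{\eta}+\sigma+\ell\eta\right)$. No bound on the gradients is assumed, and $\eta$, $v_0$ need not be related to $\ell,\sigma,\Delta,T$. -/

import Mathlib

open MeasureTheory ProbabilityTheory

noncomputable section

/-- `f` is `ℓ`-smooth: differentiable with `ℓ`-Lipschitz gradient. -/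
def IsSmooth {d : ℕ} (f : EuclideanSpace ℝ (Fin d) → ℝ) (ℓ : ℝ) : Prop :=
  Differentiable ℝ f ∧ ∀ x₁ x₂, ‖gradient f x₁ - gradient f x₂‖ ≤ ℓ * ‖x₁ - x₂‖

/-- `g x z`, with `z` drawn from `D`, is a stochastic gradient of `f`: it is unbiased and has
variance at most `σ²`, at every point `x`. -/
structure IsStochasticGradient {d : ℕ} {Ξ : Type*} [MeasurableSpace Ξ]
    (f : EuclideanSpace ℝ (Fin d) → ℝ)
    (g : EuclideanSpace ℝ (Fin d) → Ξ → EuclideanSpace ℝ (Fin d))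
    (D : Measure Ξ) (σ : ℝ) : Prop where
  measurable : Measurable (Function.uncurry g)
  integrable : ∀ x, Integrable (g x) D
  unbiased : ∀ x, ∫ z, g x z ∂D = gradient f x
  integrable_sq : ∀ x, Integrable (fun z => ‖g x z - gradient f x‖ ^ 2) D
  variance_le : ∀ x, ∫ z, ‖g x z - gradient f x‖ ^ 2 ∂D ≤ σ ^ 2

/-- The state `(x_t, v_t²)` of AdaGrad-norm started at `x₀` with parameters `η`, `v₀` and run on the
sequence of samples `z 0, z 1, …`:
`v_{t+1}² = v_t² + ‖g(x_t; z_t)‖²` and `x_{t+1} = x_t - (η / √(v_{t+1}²)) g(x_t; z_t)`. -/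
def adaGradNorm {d : ℕ} {Ξ : Type*}
    (g : EuclideanSpace ℝ (Fin d) → Ξ → EuclideanSpace ℝ (Fin d))
    (x₀ : EuclideanSpace ℝ (Fin d)) (η v₀ : ℝ) (z : ℕ → Ξ) :
    ℕ → EuclideanSpace ℝ (Fin d) × ℝ
  | 0 => (x₀, v₀ ^ 2)
  | t + 1 =>
    let s := adaGradNorm g x₀ η v₀ z t
    let w := s.2 + ‖g s.1 (z t)‖ ^ 2
    (s.1 - (η / √w) • g s.1 (z t), w)

end

/-! ### Smoothness: the descent inequality. -/

section Smooth

variable {d : ℕ} {f : EuclideanSpace ℝ (Fin d) → ℝ} {ℓ : ℝ}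

/-! The difficulty is that the step size `η / v_{t+1}` depends on the current sample.
`inner_div_sqrt_ge` replaces `1 / v_{t+1}` by `1 / u_t`, where `u_t² = v_t² + ‖∇f(x_t)‖² + σ²` is
fixed given the past, at a cost involving the noise and `r_t = ‖g_t‖² / v_{t+1}²`. The descent lemma
and Young's inequality then show (`integral_step_nonneg`) that the expected decrease of `f / η` plus
`(2σ + ℓη/2) E r_t` pays for half of `E ‖∇f(x_t)‖² / u_t`.

Summing over `t`, the values of `f` telescope to at most `Δ`, and `∑ r_t ≤ log (v_T² / v₀²)`. No
gradient bound is needed for the logarithm: each step has length at most `η`, so `‖∇f(x_t)‖ ≤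
‖∇f(x₀)‖ + ℓηt`, and `E v_T²` is polynomial in `T`. This gives `∑ E ‖∇f(x_t)‖² / u_t ≤ A`.

To remove the denominators, put `S = ∑ ‖∇f(x_t)‖²`. Every `u_t` is at most `M = v₀ + 2√S + noise`,
where the noise has mean at most `2σ√T`. Hence `E (S / M) ≤ A`, and Cauchy–Schwarz gives `(E √S)² ≤
A · E M`, a quadratic inequality in `E √S` solved in `average_integral_le`. Finally `∑ ‖∇f(x_t)‖ ≤
√T √S`. -/

theorem IsSmooth.continuous_gradient (hf : IsSmooth f ℓ) : Continuous (gradient f) := by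
  refine (LipschitzWith.of_dist_le_mul (K := ℓ.toNNReal) fun x y => ?_).continuous
  rw [dist_eq_norm, dist_eq_norm]
  exact (hf.2 x y).trans (mul_le_mul_of_nonneg_right (Real.le_coe_toNNReal ℓ) (norm_nonneg _))

/-- The descent lemma for functions with Lipschitz gradient. -/
theorem IsSmooth.le_quadratic (hf : IsSmooth f ℓ) (x h : EuclideanSpace ℝ (Fin d)) :
    f (x + h) ≤ f x + inner ℝ (gradient f x) h + ℓ / 2 * ‖h‖ ^ 2 := by
  let φ : ℝ → ℝ := fun t =>
    f (x + t • h) - t * inner ℝ (gradient f x) h - ℓ / 2 * t ^ 2 * ‖h‖ ^ 2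
  have hφ : ∀ t, HasDerivAt φ (inner ℝ (gradient f (x + t • h)) h - inner ℝ (gradient f x) h
      - ℓ * t * ‖h‖ ^ 2) t := by
    intro t
    have h1 : HasDerivAt (fun t : ℝ => x + t • h) h t := by
      simpa using ((hasDerivAt_id t).smul_const h).const_add x
    have h2 := (hf.1 (x + t • h)).hasGradientAt.hasFDerivAt.comp_hasDerivAt t h1
    have h3 : HasDerivAt (fun t : ℝ => f (x + t • h))
        (inner ℝ (gradient f (x + t • h)) h) t := by
      rw [InnerProductSpace.toDual_apply_apply] at h2
      exact h2
    have h4 : HasDerivAt (fun t : ℝ => t * inner ℝ (gradient f x) h)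
        (inner ℝ (gradient f x) h) t := by
      simpa using (hasDerivAt_id t).mul_const (inner ℝ (gradient f x) h)
    have h5 : HasDerivAt (fun t : ℝ => ℓ / 2 * t ^ 2 * ‖h‖ ^ 2) (ℓ * t * ‖h‖ ^ 2) t := by
      have := (((hasDerivAt_id t).pow 2).const_mul (ℓ / 2)).mul_const (‖h‖ ^ 2)
      refine this.congr_deriv ?_
      simp only [id, Nat.cast_ofNat, Nat.add_one_sub_one, pow_one, mul_one]
      ring
    exact (h3.sub h4).sub h5
  have hanti : AntitoneOn φ (Set.Icc 0 1) := by
    refine antitoneOn_of_deriv_nonpos (convex_Icc 0 1)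
      (fun t _ => (hφ t).continuousAt.continuousWithinAt)
      (fun t _ => (hφ t).differentiableAt.differentiableWithinAt) fun t ht => ?_
    rw [interior_Icc] at ht
    rw [(hφ t).deriv, ← inner_sub_left]
    have h1 := real_inner_le_norm (gradient f (x + t • h) - gradient f x) h
    have h2 := hf.2 (x + t • h) x
    rw [add_sub_cancel_left, norm_smul, Real.norm_of_nonneg ht.1.le] at h2
    nlinarith [mul_le_mul_of_nonneg_right h2 (norm_nonneg h)]
  have := hanti (Set.left_mem_Icc.2 zero_le_one) (Set.right_mem_Icc.2 zero_le_one) zero_le_one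
  simp only [φ, one_smul, zero_smul, add_zero] at this
  linarith

/-- A gradient step of length `1/ℓ` lowers `f` by at least `‖∇f(x)‖² / (2ℓ)`, and no step can lower
it by more than `Δ`. It is needed only at `x₀`, to bound the argument of the logarithm by the
problem parameters. -/
theorem IsSmooth.norm_gradient_sq_le (hf : IsSmooth f ℓ) (hℓ : 0 < ℓ) {Δ : ℝ}
    {x : EuclideanSpace ℝ (Fin d)} (hΔ : ∀ y, f x - f y ≤ Δ) :
    ‖gradient f x‖ ^ 2 ≤ 2 * ℓ * Δ := by
  have h := hf.le_quadratic x (-(ℓ⁻¹ • gradient f x))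
  rw [inner_neg_right, inner_smul_right, real_inner_self_eq_norm_sq, norm_neg, norm_smul,
    Real.norm_of_nonneg (inv_nonneg.2 hℓ.le), mul_pow] at h
  have h' := hΔ (x + -(ℓ⁻¹ • gradient f x))
  have e : ℓ / 2 * (ℓ⁻¹ ^ 2 * ‖gradient f x‖ ^ 2) = ℓ⁻¹ * ‖gradient f x‖ ^ 2 / 2 := by
    field_simp
  have h3 : ℓ⁻¹ * ‖gradient f x‖ ^ 2 ≤ 2 * Δ := by linarith
  calc ‖gradient f x‖ ^ 2 = ℓ * (ℓ⁻¹ * ‖gradient f x‖ ^ 2) := by field_simp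
    _ ≤ ℓ * (2 * Δ) := by gcongr
    _ = _ := by ring

end Smooth

/-- Decoupling of an adaptive step size from the current stochastic gradient `b`: the step size
`1 / √(w + ‖b‖²)` is replaced by `1 / √(w + ‖a‖² + σ²)`, which does not depend on `b`. -/
theorem inner_div_sqrt_ge {E : Type*} [NormedAddCommGroup E] [InnerProductSpace ℝ E]
    (a b : E) {w σ : ℝ} (hw : 0 < w) (hσ : 0 ≤ σ) :
    (inner ℝ a b - ‖a‖ * ((‖b - a‖ + σ) * √(‖b‖ ^ 2 / (w + ‖b‖ ^ 2)))) / √(w + ‖a‖ ^ 2 + σ ^ 2)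
      ≤ inner ℝ a b / √(w + ‖b‖ ^ 2) := by
  set v := √(w + ‖b‖ ^ 2) with hv
  set u := √(w + ‖a‖ ^ 2 + σ ^ 2) with hu
  have hv0 : 0 < v := Real.sqrt_pos.2 (by positivity)
  have hu0 : 0 < u := Real.sqrt_pos.2 (by positivity)
  have hv2 : v ^ 2 = w + ‖b‖ ^ 2 := Real.sq_sqrt (by positivity)
  have hu2 : u ^ 2 = w + ‖a‖ ^ 2 + σ ^ 2 := Real.sq_sqrt (by positivity)
  have hr : √(‖b‖ ^ 2 / (w + ‖b‖ ^ 2)) = ‖b‖ / v := by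
    rw [Real.sqrt_div (by positivity), Real.sqrt_sq (norm_nonneg _)]
  have hbv : ‖b‖ ≤ v := Real.le_sqrt_of_sq_le (by linarith)
  have hau : ‖a‖ ≤ u := Real.le_sqrt_of_sq_le (by nlinarith)
  have hσu : σ ≤ u := Real.le_sqrt_of_sq_le (by nlinarith [sq_nonneg ‖a‖])
  have hd1 : ‖b‖ - ‖a‖ ≤ ‖b - a‖ := norm_sub_norm_le b a
  have hd2 : ‖a‖ - ‖b‖ ≤ ‖b - a‖ := by rw [norm_sub_rev]; exact norm_sub_norm_le a b
  -- Since `u² - v² = ‖a‖² - ‖b‖² + σ²`, dividing by `u + v`, which dominates both `‖a‖ + ‖b‖` and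
  -- `σ`, removes one factor from each term.
  have hkey : |u - v| ≤ ‖b - a‖ + σ := by
    have e : (u - v) * (u + v) = (‖a‖ - ‖b‖) * (‖a‖ + ‖b‖) + σ * σ := by nlinarith
    have h1 : |‖a‖ - ‖b‖| ≤ ‖b - a‖ := abs_le.2 ⟨by linarith, by linarith⟩
    have h2 : |u - v| * (u + v) ≤ (‖b - a‖ + σ) * (u + v) := by
      calc |u - v| * (u + v) = |(u - v) * (u + v)| := by
            rw [abs_mul, abs_of_pos (show 0 < u + v by positivity)]
        _ ≤ |(‖a‖ - ‖b‖) * (‖a‖ + ‖b‖)| + |σ * σ| := by rw [e]; exact abs_add_le _ _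
        _ = |‖a‖ - ‖b‖| * (‖a‖ + ‖b‖) + σ * σ := by
            rw [abs_mul, abs_of_nonneg (show 0 ≤ ‖a‖ + ‖b‖ by positivity),
              abs_of_nonneg (mul_nonneg hσ hσ)]
        _ ≤ ‖b - a‖ * (u + v) + σ * (u + v) := by gcongr; linarith
        _ = _ := by ring
    exact le_of_mul_le_mul_right h2 (by positivity)
  have hin : |inner ℝ a b| ≤ ‖a‖ * ‖b‖ := abs_real_inner_le_norm a b
  rw [hr, div_le_div_iff₀ hu0 hv0]
  have h1 : inner ℝ a b * (v - u) ≤ ‖a‖ * ‖b‖ * (‖b - a‖ + σ) := by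
    calc inner ℝ a b * (v - u) ≤ |inner ℝ a b * (v - u)| := le_abs_self _
      _ = |inner ℝ a b| * |u - v| := by rw [abs_mul, abs_sub_comm]
      _ ≤ _ := by gcongr
  have h2 : (‖a‖ * ((‖b - a‖ + σ) * (‖b‖ / v))) * v = ‖a‖ * ‖b‖ * (‖b - a‖ + σ) := by
    field_simp
  nlinarith

section Step

variable {d : ℕ} {Ξ : Type*} [MeasurableSpace Ξ] {f : EuclideanSpace ℝ (Fin d) → ℝ}
  {g : EuclideanSpace ℝ (Fin d) → Ξ → EuclideanSpace ℝ (Fin d)} {D : Measure Ξ} {ℓ σ η : ℝ}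

/-- One step of AdaGrad-norm: expected decrease of the potential, given the state `(x, w)`. -/
theorem IsStochasticGradient.integral_step_nonneg [IsProbabilityMeasure D]
    (hg : IsStochasticGradient f g D σ) (hf : IsSmooth f ℓ) (hσ : 0 ≤ σ) (hη : 0 < η)
    (x : EuclideanSpace ℝ (Fin d)) {w : ℝ} (hw : 0 < w) :
    0 ≤ ∫ z, ((f x - f (x - (η / √(w + ‖g x z‖ ^ 2)) • g x z)) / η
      + (2 * σ + ℓ * η / 2) * (‖g x z‖ ^ 2 / (w + ‖g x z‖ ^ 2))
      - ‖gradient f x‖ ^ 2 / √(w + ‖gradient f x‖ ^ 2 + σ ^ 2) / 2) ∂D := by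
  set a := gradient f x with ha
  set u := √(w + ‖a‖ ^ 2 + σ ^ 2) with hu
  have hu0 : 0 < u := Real.sqrt_pos.2 (by positivity)
  have hσu : σ ≤ u := Real.le_sqrt_of_sq_le (by nlinarith [sq_nonneg ‖a‖])
  have hpt : ∀ z, (inner ℝ a (g x z) - ‖a‖ * ((‖g x z - a‖ + σ) *
      √(‖g x z‖ ^ 2 / (w + ‖g x z‖ ^ 2)))) / u
      + 2 * σ * (‖g x z‖ ^ 2 / (w + ‖g x z‖ ^ 2)) - ‖a‖ ^ 2 / u / 2 ≤
      (f x - f (x - (η / √(w + ‖g x z‖ ^ 2)) • g x z)) / η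
      + (2 * σ + ℓ * η / 2) * (‖g x z‖ ^ 2 / (w + ‖g x z‖ ^ 2)) - ‖a‖ ^ 2 / u / 2 := by
    intro z
    have h1 := inner_div_sqrt_ge a (g x z) hw hσ
    have h2 := hf.le_quadratic x (-((η / √(w + ‖g x z‖ ^ 2)) • g x z))
    rw [← sub_eq_add_neg, inner_neg_right, inner_smul_right, norm_neg, norm_smul, mul_pow,
      Real.norm_of_nonneg (by positivity), div_pow, Real.sq_sqrt (by positivity), ← ha] at h2
    have h3 : inner ℝ a (g x z) / √(w + ‖g x z‖ ^ 2)
        - ℓ * η / 2 * (‖g x z‖ ^ 2 / (w + ‖g x z‖ ^ 2)) ≤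
        (f x - f (x - (η / √(w + ‖g x z‖ ^ 2)) • g x z)) / η := by
      rw [le_div_iff₀ hη]
      have e : (inner ℝ a (g x z) / √(w + ‖g x z‖ ^ 2)
        - ℓ * η / 2 * (‖g x z‖ ^ 2 / (w + ‖g x z‖ ^ 2))) * η =
        η / √(w + ‖g x z‖ ^ 2) * inner ℝ a (g x z)
        - ℓ / 2 * (η ^ 2 / (w + ‖g x z‖ ^ 2) * ‖g x z‖ ^ 2) := by ring
      rw [e]
      linarith
    linarith
  have hr0 : ∀ z, 0 ≤ ‖g x z‖ ^ 2 / (w + ‖g x z‖ ^ 2) := fun z => by positivity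
  -- The Young weight below divides by `σ²`. Without noise, `g x z = ∇f(x)` almost surely and the
  -- decoupling error vanishes.
  rcases hσ.eq_or_lt with h0 | hpos
  · have hz : ∀ᵐ z ∂D, ‖g x z - a‖ ^ 2 = 0 := by
      have h1 : ∫ z, ‖g x z - a‖ ^ 2 ∂D = 0 := by
        refine le_antisymm ((hg.variance_le x).trans ?_) (integral_nonneg fun z => by positivity)
        rw [← h0]; norm_num
      exact (integral_eq_zero_iff_of_nonneg (fun z => by positivity) (hg.integrable_sq x)).1 h1
    refine integral_nonneg_of_ae ?_
    filter_upwards [hz] with z hz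
    refine le_trans ?_ (hpt z)
    have h1 : g x z = a := by simpa [sub_eq_zero] using hz
    rw [h1, real_inner_self_eq_norm_sq, ← h0]
    simp only [sub_self, norm_zero, add_zero, zero_mul, mul_zero, sub_zero]
    have : 0 ≤ ‖a‖ ^ 2 / u := by positivity
    show (0 : ℝ) ≤ _
    linarith
  -- A non-integrable integrand has integral `0` by convention, so the claim is then trivial.
  by_cases hF : Integrable (fun z => (f x - f (x - (η / √(w + ‖g x z‖ ^ 2)) • g x z)) / η
      + (2 * σ + ℓ * η / 2) * (‖g x z‖ ^ 2 / (w + ‖g x z‖ ^ 2)) - ‖a‖ ^ 2 / u / 2) D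
  swap
  · exact (integral_undef hF).ge
  have hi : Integrable (fun z => inner ℝ a (g x z)) D := (hg.integrable x).const_inner a
  have hδ : Integrable (fun z => ‖a‖ ^ 2 / (4 * σ ^ 2 * u) * (‖g x z - a‖ ^ 2 + σ ^ 2)) D :=
    ((hg.integrable_sq x).add (integrable_const _)).const_mul _
  have hiδ : Integrable (fun z => inner ℝ a (g x z) / u
      - ‖a‖ ^ 2 / (4 * σ ^ 2 * u) * (‖g x z - a‖ ^ 2 + σ ^ 2)) D := (hi.div_const u).sub hδ
  have hG : Integrable (fun z => inner ℝ a (g x z) / u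
      - ‖a‖ ^ 2 / (4 * σ ^ 2 * u) * (‖g x z - a‖ ^ 2 + σ ^ 2) - ‖a‖ ^ 2 / u / 2) D :=
    hiδ.sub (integrable_const _)
  refine le_trans ?_ (integral_mono hG hF fun z => ?_)
  · rw [integral_sub hiδ (integrable_const _), integral_sub (hi.div_const u) hδ, integral_div,
      integral_const_mul, integral_add (hg.integrable_sq x) (integrable_const _),
      integral_inner (hg.integrable x), hg.unbiased x, ← ha, real_inner_self_eq_norm_sq]
    simp only [integral_const, probReal_univ, one_smul]
    have h1 : ‖a‖ ^ 2 / (4 * σ ^ 2 * u) * (∫ z, ‖g x z - a‖ ^ 2 ∂D + σ ^ 2) ≤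
        ‖a‖ ^ 2 / (4 * σ ^ 2 * u) * (σ ^ 2 + σ ^ 2) := by
      gcongr
      exact hg.variance_le x
    have h2 : ‖a‖ ^ 2 / (4 * σ ^ 2 * u) * (σ ^ 2 + σ ^ 2) = ‖a‖ ^ 2 / u / 2 := by
      field_simp
      ring
    linarith
  · refine le_trans ?_ (hpt z)
    set r := ‖g x z‖ ^ 2 / (w + ‖g x z‖ ^ 2) with hr
    set δ := ‖g x z - a‖
    have hδ : 0 ≤ δ := norm_nonneg _
    have hs : √r ^ 2 = r := Real.sq_sqrt (hr0 z)
    -- Young's inequality, weighted so that `E (δ² + σ²) ≤ 2σ²` turns the first term into at most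
    -- `‖a‖² / 2`: half of the main term is spent on the error and half survives.
    have h1 : ‖a‖ * ((δ + σ) * √r) ≤
        ‖a‖ ^ 2 / (4 * σ ^ 2) * (δ ^ 2 + σ ^ 2) + 2 * σ ^ 2 * r := by
      have h2 : 0 ≤ (‖a‖ * (δ + σ) - 4 * σ ^ 2 * √r) ^ 2 / (8 * σ ^ 2) := by positivity
      have h3 : (‖a‖ * (δ + σ) - 4 * σ ^ 2 * √r) ^ 2 / (8 * σ ^ 2)
          = ‖a‖ ^ 2 / (4 * σ ^ 2) * ((δ + σ) ^ 2 / 2) - ‖a‖ * ((δ + σ) * √r)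
            + 2 * σ ^ 2 * √r ^ 2 := by
        field_simp
        ring
      have h4 : ‖a‖ ^ 2 / (4 * σ ^ 2) * ((δ + σ) ^ 2 / 2) ≤
          ‖a‖ ^ 2 / (4 * σ ^ 2) * (δ ^ 2 + σ ^ 2) := by
        gcongr
        linarith [add_sq_le (a := δ) (b := σ)]
      rw [hs] at h3
      linarith
    have h6 : 2 * σ ^ 2 * r / u ≤ 2 * σ * r := by
      rw [div_le_iff₀ hu0]
      nlinarith [mul_le_mul_of_nonneg_left hσu (mul_nonneg hσ (hr0 z))]
    have h7 := div_le_div_of_nonneg_right h1 hu0.le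
    have h8 : ‖a‖ ^ 2 / (4 * σ ^ 2 * u) * (δ ^ 2 + σ ^ 2)
        = ‖a‖ ^ 2 / (4 * σ ^ 2) * (δ ^ 2 + σ ^ 2) / u := by
      field_simp
    have h9 : (‖a‖ ^ 2 / (4 * σ ^ 2) * (δ ^ 2 + σ ^ 2) + 2 * σ ^ 2 * r) / u
       = ‖a‖ ^ 2 / (4 * σ ^ 2) * (δ ^ 2 + σ ^ 2) / u + 2 * σ ^ 2 * r / u := add_div _ _ _
    have h10 : (inner ℝ a (g x z) - ‖a‖ * ((δ + σ) * √r)) / u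
      = inner ℝ a (g x z) / u - ‖a‖ * ((δ + σ) * √r) / u := sub_div _ _ _
    linarith

end Step

/-! ### Integrating out an independent sample. -/

section Independence

variable {Ω α β : Type*} [MeasurableSpace Ω] [MeasurableSpace α] [MeasurableSpace β]
  {P : Measure Ω} [IsProbabilityMeasure P] {X : Ω → α} {Y : Ω → β}

/-- Freezing: the joint law is a product, so Fubini lets bounds at a fixed state be applied at the
random state. -/
theorem ProbabilityTheory.IndepFun.integral_comp_prodMk (h : IndepFun X Y P)
    (hX : Measurable X) (hY : Measurable Y) {F : α × β → ℝ} (hF : Measurable F)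
    (hi : Integrable (fun ω => F (X ω, Y ω)) P) :
    ∫ ω, F (X ω, Y ω) ∂P = ∫ ω, ∫ y, F (X ω, y) ∂(P.map Y) ∂P := by
  have hmap := (indepFun_iff_map_prod_eq_prod_map_map hX.aemeasurable hY.aemeasurable).1 h
  have := Measure.isProbabilityMeasure_map (μ := P) hX.aemeasurable
  have := Measure.isProbabilityMeasure_map (μ := P) hY.aemeasurable
  have hi' : Integrable F ((P.map X).prod (P.map Y)) := by
    rw [← hmap]
    exact (integrable_map_measure hF.aestronglyMeasurable (hX.prodMk hY).aemeasurable).2 hi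
  rw [← integral_map (f := F) (hX.prodMk hY).aemeasurable hF.aestronglyMeasurable, hmap,
    integral_prod _ hi', integral_map hX.aemeasurable]
  exact hF.stronglyMeasurable.integral_prod_right'.aestronglyMeasurable

theorem ProbabilityTheory.IndepFun.integrable_comp_prodMk_of_integral_le (h : IndepFun X Y P)
    (hX : Measurable X) (hY : Measurable Y) {F : α × β → ℝ} (hF : Measurable F)
    (h0 : ∀ p, 0 ≤ F p) (hi : ∀ x, Integrable (fun y => F (x, y)) (P.map Y)) {c : ℝ}
    (hc : ∀ x, ∫ y, F (x, y) ∂(P.map Y) ≤ c) :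
    Integrable (fun ω => F (X ω, Y ω)) P ∧ ∫ ω, F (X ω, Y ω) ∂P ≤ c := by
  have hmap := (indepFun_iff_map_prod_eq_prod_map_map hX.aemeasurable hY.aemeasurable).1 h
  have := Measure.isProbabilityMeasure_map (μ := P) hX.aemeasurable
  have := Measure.isProbabilityMeasure_map (μ := P) hY.aemeasurable
  have hm : StronglyMeasurable fun x => ∫ y, F (x, y) ∂(P.map Y) :=
    hF.stronglyMeasurable.integral_prod_right'
  have hi' : Integrable F ((P.map X).prod (P.map Y)) := by
    refine (integrable_prod_iff hF.aestronglyMeasurable).2 ⟨ae_of_all _ hi, ?_⟩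
    simp_rw [Real.norm_of_nonneg (h0 _)]
    refine Integrable.of_bound hm.aestronglyMeasurable c (ae_of_all _ fun x => ?_)
    rw [Real.norm_of_nonneg (integral_nonneg fun y => h0 _)]
    exact hc x
  have hI : Integrable (fun ω => F (X ω, Y ω)) P := by
    rw [← hmap] at hi'
    exact (integrable_map_measure hF.aestronglyMeasurable (hX.prodMk hY).aemeasurable).1 hi'
  refine ⟨hI, ?_⟩
  rw [h.integral_comp_prodMk hX hY hF hI]
  have hm' : Measurable fun ω => ∫ y, F (X ω, y) ∂(P.map Y) := hm.measurable.comp hX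
  calc ∫ ω, ∫ y, F (X ω, y) ∂(P.map Y) ∂P ≤ ∫ _, c ∂P := by
        refine integral_mono ?_ (integrable_const c) fun ω => hc (X ω)
        refine Integrable.of_bound hm'.aestronglyMeasurable c (ae_of_all _ fun ω => ?_)
        rw [Real.norm_of_nonneg (integral_nonneg fun y => h0 _)]
        exact hc _
    _ = c := by simp

theorem sq_integral_le_integral_sq {R : Ω → ℝ} (hR : Integrable R P)
    (hR2 : Integrable (fun ω => R ω ^ 2) P) : (∫ ω, R ω ∂P) ^ 2 ≤ ∫ ω, R ω ^ 2 ∂P := by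
  set m := ∫ ω, R ω ∂P with hm
  -- The tangent line to the square at the mean `m` lies below the parabola.
  have h : ∫ ω, (2 * m * R ω - m ^ 2) ∂P ≤ ∫ ω, R ω ^ 2 ∂P :=
    integral_mono ((hR.const_mul _).sub (integrable_const _)) hR2 fun ω => by
      show 2 * m * R ω - m ^ 2 ≤ R ω ^ 2
      nlinarith [sq_nonneg (R ω - m)]
  rw [integral_sub (hR.const_mul _) (integrable_const _), integral_const_mul, ← hm] at h
  simp only [integral_const, probReal_univ, one_smul] at h
  linarith

end Independence

/-! ### Pathwise bounds, measurability and independence of the iterates. -/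

section Iterates

variable {d : ℕ} {Ξ : Type*} {g : EuclideanSpace ℝ (Fin d) → Ξ → EuclideanSpace ℝ (Fin d)}
  {x₀ : EuclideanSpace ℝ (Fin d)} {η v₀ : ℝ} {z : ℕ → Ξ}

theorem adaGradNorm_succ_fst (t : ℕ) :
    (adaGradNorm g x₀ η v₀ z (t + 1)).1 = (adaGradNorm g x₀ η v₀ z t).1
      - (η / √((adaGradNorm g x₀ η v₀ z t).2 + ‖g (adaGradNorm g x₀ η v₀ z t).1 (z t)‖ ^ 2)) •
        g (adaGradNorm g x₀ η v₀ z t).1 (z t) := rfl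

theorem adaGradNorm_succ_snd (t : ℕ) :
    (adaGradNorm g x₀ η v₀ z (t + 1)).2 = (adaGradNorm g x₀ η v₀ z t).2
      + ‖g (adaGradNorm g x₀ η v₀ z t).1 (z t)‖ ^ 2 := rfl

theorem adaGradNorm_snd_eq_sum (t : ℕ) :
    (adaGradNorm g x₀ η v₀ z t).2
      = v₀ ^ 2 + ∑ s ∈ Finset.range t, ‖g (adaGradNorm g x₀ η v₀ z s).1 (z s)‖ ^ 2 := by
  induction t with
  | zero => simp [adaGradNorm]
  | succ t ih => rw [adaGradNorm_succ_snd, ih, Finset.sum_range_succ, add_assoc]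

theorem adaGradNorm_snd_pos (hv : 0 < v₀) (t : ℕ) : 0 < (adaGradNorm g x₀ η v₀ z t).2 := by
  rw [adaGradNorm_snd_eq_sum]
  positivity

/-- The current gradient is included in its own normaliser, so each step has length at most `η`.
This deterministic confinement makes `f` and `∇f` bounded along the iterates at each fixed time. -/
theorem norm_adaGradNorm_fst_sub_le (hη : 0 ≤ η) (hv : 0 < v₀) (t : ℕ) :
    ‖(adaGradNorm g x₀ η v₀ z t).1 - x₀‖ ≤ η * t := by
  induction t with
  | zero => simp [adaGradNorm]
  | succ t ih =>
    have hw := adaGradNorm_snd_pos (g := g) (x₀ := x₀) (η := η) (z := z) hv t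
    rw [adaGradNorm_succ_fst, sub_right_comm]
    refine (norm_sub_le _ _).trans ?_
    push_cast
    rw [mul_add, mul_one]
    refine add_le_add ih ?_
    set b := g (adaGradNorm g x₀ η v₀ z t).1 (z t)
    set w := (adaGradNorm g x₀ η v₀ z t).2
    have h0 : 0 < √(w + ‖b‖ ^ 2) := Real.sqrt_pos.2 (by positivity)
    rw [norm_smul, Real.norm_of_nonneg (by positivity), div_mul_eq_mul_div, div_le_iff₀ h0]
    gcongr
    exact Real.le_sqrt_of_sq_le (by linarith)

/-- The normalised squared gradients telescope logarithmically. -/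
theorem sum_normalized_le_log (hv : 0 < v₀) (T : ℕ) :
    ∑ t ∈ Finset.range T, ‖g (adaGradNorm g x₀ η v₀ z t).1 (z t)‖ ^ 2
        / ((adaGradNorm g x₀ η v₀ z t).2 + ‖g (adaGradNorm g x₀ η v₀ z t).1 (z t)‖ ^ 2)
      ≤ Real.log ((adaGradNorm g x₀ η v₀ z T).2 / v₀ ^ 2) := by
  induction T with
  | zero => simp [adaGradNorm, hv.ne']
  | succ t ih =>
    rw [Finset.sum_range_succ]
    have hw := adaGradNorm_snd_pos (g := g) (x₀ := x₀) (η := η) (z := z) hv t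
    have hw' := adaGradNorm_snd_pos (g := g) (x₀ := x₀) (η := η) (z := z) hv (t + 1)
    rw [← adaGradNorm_succ_snd]
    set w := (adaGradNorm g x₀ η v₀ z t).2
    have e : ‖g (adaGradNorm g x₀ η v₀ z t).1 (z t)‖ ^ 2
        = (adaGradNorm g x₀ η v₀ z (t + 1)).2 - w := by
      rw [adaGradNorm_succ_snd]; ring
    rw [e]
    set w' := (adaGradNorm g x₀ η v₀ z (t + 1)).2
    -- The increment `(w' - w) / w' = 1 - w / w'` is at most `log (w' / w)`.
    have h := Real.log_le_sub_one_of_pos (div_pos hw hw')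
    rw [Real.log_div hw.ne' hw'.ne'] at h
    rw [Real.log_div hw.ne' (by positivity)] at ih
    rw [Real.log_div hw'.ne' (by positivity), sub_div, div_self hw'.ne']
    linarith

variable [MeasurableSpace Ξ]

/-- Only samples before time `t` are required to be measurable, so that `Ω` may carry the σ-algebra
they generate; this is how `indepFun_adaGradNorm` uses it. -/
theorem measurable_adaGradNorm {Ω : Type*} [MeasurableSpace Ω] {ξ : ℕ → Ω → Ξ}
    (hg : Measurable (Function.uncurry g)) (t : ℕ) (hξ : ∀ s < t, Measurable (ξ s)) :
    Measurable fun ω => adaGradNorm g x₀ η v₀ (fun k => ξ k ω) t := by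
  induction t with
  | zero => exact measurable_const
  | succ t ih =>
    have hs := ih fun s hs => hξ s (hs.trans t.lt_succ_self)
    have hG : Measurable fun ω => g (adaGradNorm g x₀ η v₀ (fun k => ξ k ω) t).1 (ξ t ω) :=
      hg.comp (hs.fst.prodMk (hξ t t.lt_succ_self))
    have hw : Measurable fun ω => (adaGradNorm g x₀ η v₀ (fun k => ξ k ω) t).2
        + ‖g (adaGradNorm g x₀ η v₀ (fun k => ξ k ω) t).1 (ξ t ω)‖ ^ 2 :=
      hs.snd.add (hG.norm.pow_const 2)
    exact (hs.fst.sub ((measurable_const.div hw.sqrt).smul hG)).prodMk hw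

theorem indepFun_adaGradNorm {Ω : Type*} [MeasurableSpace Ω] {P : Measure Ω}
    {ξ : ℕ → Ω → Ξ} (hg : Measurable (Function.uncurry g)) (hξ : ∀ t, Measurable (ξ t))
    (hind : iIndepFun ξ P) (t : ℕ) :
    IndepFun (fun ω => adaGradNorm g x₀ η v₀ (fun k => ξ k ω) t) (ξ t) P := by
  have h := indep_iSup_of_disjoint (fun k => (hξ k).comap_le) hind
    (S := Set.Iio t) (T := {t}) (by simp)
  refine (IndepFun_iff_Indep _ _ _).2 ?_
  refine indep_of_indep_of_le_left (indep_of_indep_of_le_right h ?_) ?_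
  · exact le_iSup₂_of_le t rfl le_rfl
  · refine Measurable.comap_le (@measurable_adaGradNorm d Ξ g x₀ η v₀ _ Ω
      (⨆ k ∈ Set.Iio t, MeasurableSpace.comap (ξ k) inferInstance) ξ hg t fun s hs => ?_)
    exact Measurable.of_comap_le (le_iSup₂_of_le (f := fun k (_ : k ∈ Set.Iio t) =>
      MeasurableSpace.comap (ξ k) inferInstance) s hs le_rfl)

end Iterates

/-! ### From the weighted sum to the average gradient norm. -/

section Averaging

/-- From a bound on `∑ α_t² / √(w_t + α_t² + σ²)`, where `w_t` grows at most like the partial sums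
of `2 α_s² + 2 δ_s²`, to a bound on the average of `α_t`, pathwise. -/
theorem two_mul_sqrt_sum_sq_le {α δ w : ℕ → ℝ} {v₀ σ : ℝ} {T : ℕ} (hv : 0 < v₀)
    (hw0 : ∀ t, 0 < w t)
    (hw : ∀ t, w t ≤ v₀ ^ 2 + ∑ s ∈ Finset.range t, (2 * α s ^ 2 + 2 * δ s ^ 2))
    {c : ℝ} (hc : 0 < c) :
    2 * √(∑ t ∈ Finset.range T, α t ^ 2) ≤
      c * ∑ t ∈ Finset.range T, α t ^ 2 / √(w t + α t ^ 2 + σ ^ 2)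
        + (v₀ + 2 * √(∑ t ∈ Finset.range T, α t ^ 2)
            + √(2 * ∑ t ∈ Finset.range T, δ t ^ 2 + σ ^ 2)) / c := by
  set S2 := ∑ t ∈ Finset.range T, α t ^ 2 with hS2
  set R2 := 2 * ∑ t ∈ Finset.range T, δ t ^ 2 + σ ^ 2 with hR2
  have hS0 : 0 ≤ S2 := Finset.sum_nonneg fun t _ => by positivity
  have hR0 : 0 ≤ R2 := by positivity
  set M := v₀ + 2 * √S2 + √R2 with hM
  have hM0 : 0 < M := by positivity
  -- The sum bounding `w t` stops before `t`; the extra `α t ^ 2` is absorbed by the summand of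
  -- index `t < T`.
  have hden : ∀ t ∈ Finset.range T, √(w t + α t ^ 2 + σ ^ 2) ≤ M := by
    intro t ht
    refine Real.sqrt_le_iff.2 ⟨hM0.le, ?_⟩
    have h1 : ∑ s ∈ Finset.range (t + 1), (2 * α s ^ 2 + 2 * δ s ^ 2)
        ≤ ∑ s ∈ Finset.range T, (2 * α s ^ 2 + 2 * δ s ^ 2) :=
      Finset.sum_le_sum_of_subset_of_nonneg
        (Finset.range_subset_range.2 (Finset.mem_range.1 ht)) fun s _ _ => by positivity
    rw [Finset.sum_range_succ, Finset.sum_add_distrib (s := Finset.range T), ← Finset.mul_sum,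
      ← Finset.mul_sum, ← hS2] at h1
    have h2 : v₀ ^ 2 + 2 * S2 + R2 ≤ M ^ 2 := by
      have e1 := Real.sq_sqrt hS0
      have e2 := Real.sq_sqrt hR0
      have p1 : 0 ≤ v₀ * √S2 := by positivity
      have p2 : 0 ≤ v₀ * √R2 := by positivity
      have p3 : 0 ≤ √S2 * √R2 := by positivity
      rw [hM]
      nlinarith
    nlinarith [hw t, sq_nonneg (α t), sq_nonneg (δ t)]
  have hsum : S2 / M ≤ ∑ t ∈ Finset.range T, α t ^ 2 / √(w t + α t ^ 2 + σ ^ 2) := by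
    rw [hS2, Finset.sum_div]
    refine Finset.sum_le_sum fun t ht => ?_
    have := hw0 t
    exact div_le_div_of_nonneg_left (by positivity) (Real.sqrt_pos.2 (by positivity)) (hden t ht)
  -- AM-GM with a free parameter `c`: the right side is linear in `S2 / M` and `M`, so it can be
  -- integrated, and choosing `c` afterwards recovers Cauchy–Schwarz in expectation.
  have h3 : 2 * √S2 ≤ c * (S2 / M) + M / c := by
    have h4 : 0 ≤ (c * √S2 - M) ^ 2 / (c * M) := by positivity
    have h5 : (c * √S2 - M) ^ 2 / (c * M) = c * (√S2 ^ 2 / M) + M / c - 2 * √S2 := by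
      field_simp
      ring
    rw [Real.sq_sqrt hS0] at h5
    linarith
  exact h3.trans (add_le_add_left (mul_le_mul_of_nonneg_left hsum hc.le) _)

variable {Ω : Type*} [MeasurableSpace Ω] {P : Measure Ω} [IsProbabilityMeasure P]

theorem integrable_sqrt_of_integrable {R : Ω → ℝ} (hR : Integrable R P) (h0 : ∀ ω, 0 ≤ R ω) :
    Integrable (fun ω => √(R ω)) P := by
  refine Integrable.mono' ((integrable_const (1 : ℝ)).add hR)
    (Real.continuous_sqrt.comp_aestronglyMeasurable hR.aestronglyMeasurable)
    (ae_of_all _ fun ω => ?_)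
  rw [Real.norm_of_nonneg (Real.sqrt_nonneg _)]
  show √(R ω) ≤ 1 + R ω
  nlinarith [Real.sq_sqrt (h0 ω), sq_nonneg (√(R ω) - 1), Real.sqrt_nonneg (R ω)]

theorem average_integral_le {α δ w : ℕ → Ω → ℝ} {v₀ σ A : ℝ} {T : ℕ} (hv : 0 < v₀) (hσ : 0 ≤ σ)
    (hA : 0 < A) (hT : 1 ≤ T) (hw0 : ∀ t ω, 0 < w t ω)
    (hw : ∀ t ω, w t ω ≤ v₀ ^ 2 + ∑ s ∈ Finset.range t, (2 * α s ω ^ 2 + 2 * δ s ω ^ 2))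
    (hαi : ∀ t, Integrable (α t) P) (hαi2 : ∀ t, Integrable (fun ω => α t ω ^ 2) P)
    (hδi : ∀ t, Integrable (fun ω => δ t ω ^ 2) P)
    (hδ : ∀ t, ∫ ω, δ t ω ^ 2 ∂P ≤ σ ^ 2)
    (hi : ∀ t, Integrable (fun ω => α t ω ^ 2 / √(w t ω + α t ω ^ 2 + σ ^ 2)) P)
    (hle : ∑ t ∈ Finset.range T, ∫ ω, α t ω ^ 2 / √(w t ω + α t ω ^ 2 + σ ^ 2) ∂P ≤ A) :
    (1 / (T : ℝ)) * ∑ t ∈ Finset.range T, ∫ ω, α t ω ∂P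
      ≤ 2 * A / √(T : ℝ) + √(v₀ * A) / √(T : ℝ) + 2 * √(A * σ) / (T : ℝ) ^ (1 / 4 : ℝ) := by
  have hT0 : (0 : ℝ) < T := by exact_mod_cast hT
  have hT1 : (1 : ℝ) ≤ T := by exact_mod_cast hT
  have hS2i : Integrable (fun ω => ∑ t ∈ Finset.range T, α t ω ^ 2) P :=
    integrable_finsetSum _ fun t _ => hαi2 t
  have hSi : Integrable (fun ω => √(∑ t ∈ Finset.range T, α t ω ^ 2)) P :=
    integrable_sqrt_of_integrable hS2i fun ω => Finset.sum_nonneg fun t _ => by positivity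
  have hNi : Integrable (fun ω => ∑ t ∈ Finset.range T, δ t ω ^ 2) P :=
    integrable_finsetSum _ fun t _ => hδi t
  have hR2i : Integrable (fun ω => 2 * ∑ t ∈ Finset.range T, δ t ω ^ 2 + σ ^ 2) P :=
    (hNi.const_mul 2).add (integrable_const _)
  have hR0 : ∀ ω, 0 ≤ 2 * ∑ t ∈ Finset.range T, δ t ω ^ 2 + σ ^ 2 := fun ω => by positivity
  have hRi := integrable_sqrt_of_integrable hR2i hR0
  have hVi : Integrable (fun ω => ∑ t ∈ Finset.range T,
      α t ω ^ 2 / √(w t ω + α t ω ^ 2 + σ ^ 2)) P := integrable_finsetSum _ fun t _ => hi t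
  set m := ∫ ω, √(∑ t ∈ Finset.range T, α t ω ^ 2) ∂P with hm
  have hm0 : 0 ≤ m := integral_nonneg fun ω => Real.sqrt_nonneg _
  set k := (T : ℝ) ^ (1 / 4 : ℝ) with hk
  have hk0 : 0 < k := Real.rpow_pos_of_pos hT0 _
  have hk2 : k ^ 2 = √(T : ℝ) := by
    rw [hk, ← Real.rpow_natCast, ← Real.rpow_mul hT0.le, Real.sqrt_eq_rpow]
    norm_num
  have hk4 : k ^ 4 = T := by
    rw [show k ^ 4 = (k ^ 2) ^ 2 by ring, hk2, Real.sq_sqrt hT0.le]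
  -- Jensen gives at most `√(2Tσ² + σ²)`, which is at most `2σ√T` because `T ≥ 1`.
  have hER : ∫ ω, √(2 * ∑ t ∈ Finset.range T, δ t ω ^ 2 + σ ^ 2) ∂P ≤ 2 * (σ * k ^ 2) := by
    have h1 := sq_integral_le_integral_sq hRi (by simp_rw [Real.sq_sqrt (hR0 _)]; exact hR2i)
    simp_rw [Real.sq_sqrt (hR0 _)] at h1
    rw [integral_add (hNi.const_mul 2) (integrable_const _), integral_const_mul,
      integral_finsetSum _ fun t _ => hδi t] at h1
    simp only [integral_const, probReal_univ, one_smul] at h1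
    have h2 : ∑ t ∈ Finset.range T, ∫ ω, δ t ω ^ 2 ∂P ≤ T * σ ^ 2 := by
      refine (Finset.sum_le_sum fun t _ => hδ t).trans ?_
      simp
    refine abs_le_of_sq_le_sq' ?_ (by positivity) |>.2
    have h3 : (2 * (σ * k ^ 2)) ^ 2 = 4 * (T * σ ^ 2) := by rw [← hk4]; ring
    rw [h3]
    nlinarith [mul_le_mul_of_nonneg_right hT1 (sq_nonneg σ)]
  have hquad : ∀ c : ℝ, 0 < c → 2 * m ≤ c * A + (v₀ + 2 * m + 2 * (σ * k ^ 2)) / c := by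
    intro c hc
    have hMi : Integrable (fun ω => v₀ + 2 * √(∑ t ∈ Finset.range T, α t ω ^ 2)) P :=
      (integrable_const _).add (hSi.const_mul 2)
    have hMRi : Integrable (fun ω => v₀ + 2 * √(∑ t ∈ Finset.range T, α t ω ^ 2)
        + √(2 * ∑ t ∈ Finset.range T, δ t ω ^ 2 + σ ^ 2)) P := hMi.add hRi
    have h1 := integral_mono (hSi.const_mul 2) ((hVi.const_mul c).add (hMRi.div_const c))
      fun ω => two_mul_sqrt_sum_sq_le (σ := σ) (T := T) hv (hw0 · ω) (hw · ω) hc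
    simp only [Pi.add_apply] at h1
    rw [integral_const_mul, integral_add (hVi.const_mul c) (hMRi.div_const c),
      integral_const_mul, integral_finsetSum _ fun t _ => hi t, integral_div,
      integral_add hMi hRi, integral_add (integrable_const _) (hSi.const_mul 2),
      integral_const_mul, ← hm] at h1
    simp only [integral_const, probReal_univ, one_smul] at h1
    refine h1.trans ?_
    gcongr
  have hm2 : m ^ 2 ≤ A * (v₀ + 2 * m + 2 * (σ * k ^ 2)) := by
    rcases hm0.eq_or_lt with h0 | h0
    · rw [← h0]
      have : 0 ≤ A * (v₀ + 2 * 0 + 2 * (σ * k ^ 2)) := by positivity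
      simpa using this
    -- With this `c`, the term `c * A` equals `m` and cancels half of the left side.
    · have h1 := hquad (m / A) (by positivity)
      rw [div_mul_cancel₀ _ hA.ne', div_div_eq_mul_div] at h1
      have h2 : m ≤ (v₀ + 2 * m + 2 * (σ * k ^ 2)) * A / m := by linarith
      rw [le_div_iff₀ h0] at h2
      linarith
  have hmle : m ≤ 2 * A + √(v₀ * A) + 2 * √(A * σ) * k := by
    by_contra! hlt
    have e1 := Real.sq_sqrt (show 0 ≤ v₀ * A by positivity)
    have e2 := Real.sq_sqrt (show 0 ≤ A * σ by positivity)
    set p := √(v₀ * A)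
    set q := √(A * σ)
    have hp : 0 ≤ p := Real.sqrt_nonneg _
    have hq : 0 ≤ q := Real.sqrt_nonneg _
    have hqk : 0 ≤ q * k := by positivity
    -- If `m` exceeds the sum, it exceeds each summand, so `m²` exceeds `2Am + p² + (2qk)²`,
    -- contradicting `hm2`.
    have h1 : m * (2 * A + p + 2 * q * k) < m * m := by
      refine mul_lt_mul_of_pos_left hlt ?_
      exact lt_of_le_of_lt (by positivity) hlt
    have h2 : p * p ≤ m * p := by
      refine mul_le_mul_of_nonneg_right ?_ hp
      linarith
    have h3 : (2 * q * k) * (2 * q * k) ≤ m * (2 * q * k) := by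
      refine mul_le_mul_of_nonneg_right ?_ (by positivity)
      linarith
    have h4 : (2 * q * k) * (2 * q * k) = 4 * (A * σ) * k ^ 2 := by rw [← e2]; ring
    have h5 : 0 ≤ A * σ * k ^ 2 := by positivity
    nlinarith
  have hsq : 0 < √(T : ℝ) := Real.sqrt_pos.2 hT0
  have hsum : ∑ t ∈ Finset.range T, ∫ ω, α t ω ∂P ≤ √(T : ℝ) * m := by
    rw [← integral_finsetSum _ fun t _ => hαi t, hm, ← integral_const_mul]
    refine integral_mono (integrable_finsetSum _ fun t _ => hαi t) (hSi.const_mul _) fun ω => ?_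
    show _ ≤ √(T : ℝ) * √(∑ t ∈ Finset.range T, α t ω ^ 2)
    rw [← Real.sqrt_mul hT0.le]
    refine Real.le_sqrt_of_sq_le ?_
    simpa using sq_sum_le_card_mul_sum_sq (s := Finset.range T) (f := fun t => α t ω)
  calc (1 / (T : ℝ)) * ∑ t ∈ Finset.range T, ∫ ω, α t ω ∂P
      ≤ (1 / (T : ℝ)) * (√(T : ℝ) * m) := by gcongr
    _ = m / k ^ 2 := by 
      rw [← hk2, ← hk4]
      field_simp
    _ ≤ (2 * A + √(v₀ * A) + 2 * √(A * σ) * k) / k ^ 2 := by gcongr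
    _ = _ := by
      rw [← hk2]
      field_simp

end Averaging

/-! ### Moments and integrability along the run; the one-step inequality. -/

section Run

variable {d : ℕ} {f : EuclideanSpace ℝ (Fin d) → ℝ} {ℓ σ Δ η v₀ : ℝ} {Ξ : Type*}
  {g : EuclideanSpace ℝ (Fin d) → Ξ → EuclideanSpace ℝ (Fin d)} {x₀ : EuclideanSpace ℝ (Fin d)}

theorem IsSmooth.norm_gradient_adaGradNorm_le (hf : IsSmooth f ℓ) (hℓ : 0 ≤ ℓ) (hη : 0 ≤ η)
    (hv : 0 < v₀) (z : ℕ → Ξ) (t : ℕ) :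
    ‖gradient f (adaGradNorm g x₀ η v₀ z t).1‖ ≤ ‖gradient f x₀‖ + ℓ * (η * t) := by
  have h1 := hf.2 (adaGradNorm g x₀ η v₀ z t).1 x₀
  have h2 := norm_adaGradNorm_fst_sub_le (g := g) (x₀ := x₀) (z := z) hη hv t
  have h3 := norm_sub_norm_le (gradient f (adaGradNorm g x₀ η v₀ z t).1) (gradient f x₀)
  linarith [mul_le_mul_of_nonneg_left h2 hℓ]

theorem exists_abs_adaGradNorm_le (hf : Continuous f) (hη : 0 ≤ η) (hv : 0 < v₀) (t : ℕ) :
    ∃ K, ∀ z : ℕ → Ξ, |f (adaGradNorm g x₀ η v₀ z t).1| ≤ K := by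
  obtain ⟨K, hK⟩ := (isCompact_closedBall x₀ (η * t)).exists_bound_of_continuousOn hf.continuousOn
  exact ⟨K, fun z => hK _ (mem_closedBall_iff_norm.2 (norm_adaGradNorm_fst_sub_le hη hv t))⟩

variable [MeasurableSpace Ξ] {D : Measure Ξ}
  {Ω : Type*} [MeasurableSpace Ω] {P : Measure Ω} [IsProbabilityMeasure P] {ξ : ℕ → Ω → Ξ}

theorem IsStochasticGradient.noise_adaGradNorm (hg : IsStochasticGradient f g D σ)
    (hf : IsSmooth f ℓ) (hξ : ∀ t, Measurable (ξ t)) (hD : ∀ t, P.map (ξ t) = D)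
    (hind : iIndepFun ξ P) (t : ℕ) :
    Integrable (fun ω => ‖g (adaGradNorm g x₀ η v₀ (fun k => ξ k ω) t).1 (ξ t ω)
        - gradient f (adaGradNorm g x₀ η v₀ (fun k => ξ k ω) t).1‖ ^ 2) P ∧
      ∫ ω, ‖g (adaGradNorm g x₀ η v₀ (fun k => ξ k ω) t).1 (ξ t ω)
        - gradient f (adaGradNorm g x₀ η v₀ (fun k => ξ k ω) t).1‖ ^ 2 ∂P ≤ σ ^ 2 := by
  have hm : Measurable fun p : (EuclideanSpace ℝ (Fin d) × ℝ) × Ξ =>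
      ‖g p.1.1 p.2 - gradient f p.1.1‖ ^ 2 :=
    ((hg.measurable.comp (measurable_fst.fst.prodMk measurable_snd)).sub
      (hf.continuous_gradient.measurable.comp measurable_fst.fst)).norm.pow_const 2
  refine (indepFun_adaGradNorm (x₀ := x₀) (η := η) (v₀ := v₀) hg.measurable hξ hind
    t).integrable_comp_prodMk_of_integral_le
    (measurable_adaGradNorm hg.measurable t fun s _ => hξ s) (hξ t) hm
    (fun _ => by positivity) (fun s => ?_) (fun s => ?_)
  · rw [hD]; exact hg.integrable_sq s.1
  · rw [hD]; exact hg.variance_le s.1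

theorem norm_sq_le_two_mul_add {E : Type*} [NormedAddCommGroup E] (a b : E) :
    ‖b‖ ^ 2 ≤ 2 * ‖a‖ ^ 2 + 2 * ‖b - a‖ ^ 2 := by
  have h1 : ‖b‖ ≤ ‖a‖ + ‖b - a‖ := by simpa using norm_add_le a (b - a)
  nlinarith [norm_nonneg b, sq_nonneg (‖a‖ - ‖b - a‖)]

/-- The bound grows with `t`, which is harmless: it enters the rate only through a logarithm. -/
theorem IsStochasticGradient.integrable_norm_sq_adaGradNorm (hg : IsStochasticGradient f g D σ)
    (hf : IsSmooth f ℓ) (hℓ : 0 ≤ ℓ) (hη : 0 ≤ η) (hv : 0 < v₀)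
    (hξ : ∀ t, Measurable (ξ t)) (hD : ∀ t, P.map (ξ t) = D) (hind : iIndepFun ξ P) (t : ℕ) :
    Integrable (fun ω => ‖g (adaGradNorm g x₀ η v₀ (fun k => ξ k ω) t).1 (ξ t ω)‖ ^ 2) P ∧
      ∫ ω, ‖g (adaGradNorm g x₀ η v₀ (fun k => ξ k ω) t).1 (ξ t ω)‖ ^ 2 ∂P
        ≤ 2 * (‖gradient f x₀‖ + ℓ * (η * t)) ^ 2 + 2 * σ ^ 2 := by
  obtain ⟨hi, hle⟩ := hg.noise_adaGradNorm (x₀ := x₀) (η := η) (v₀ := v₀) hf hξ hD hind t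
  set G := ‖gradient f x₀‖ + ℓ * (η * t)
  have hpt : ∀ ω, ‖g (adaGradNorm g x₀ η v₀ (fun k => ξ k ω) t).1 (ξ t ω)‖ ^ 2 ≤
      2 * G ^ 2 + 2 * ‖g (adaGradNorm g x₀ η v₀ (fun k => ξ k ω) t).1 (ξ t ω)
        - gradient f (adaGradNorm g x₀ η v₀ (fun k => ξ k ω) t).1‖ ^ 2 := by
    intro ω
    refine (norm_sq_le_two_mul_add (gradient f (adaGradNorm g x₀ η v₀ (fun k => ξ k ω) t).1)
      _).trans ?_
    have := hf.norm_gradient_adaGradNorm_le (g := g) (x₀ := x₀) hℓ hη hv (fun k => ξ k ω) t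
    gcongr
  have hm : Measurable fun ω => ‖g (adaGradNorm g x₀ η v₀ (fun k => ξ k ω) t).1 (ξ t ω)‖ ^ 2 :=
    (hg.measurable.comp ((measurable_adaGradNorm hg.measurable t fun s _ => hξ s).fst.prodMk
      (hξ t))).norm.pow_const 2
  have hI := (integrable_const (μ := P) (2 * G ^ 2)).add (hi.const_mul 2)
  have hI' : Integrable (fun ω => ‖g (adaGradNorm g x₀ η v₀ (fun k => ξ k ω) t).1 (ξ t ω)‖ ^ 2)
      P := by
    refine hI.mono' hm.aestronglyMeasurable (ae_of_all _ fun ω => ?_)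
    rw [Real.norm_of_nonneg (by positivity)]
    exact hpt ω
  refine ⟨hI', (integral_mono hI' hI hpt).trans ?_⟩
  rw [integral_add' (integrable_const _) (hi.const_mul 2), integral_const, probReal_univ, one_smul,
    integral_const_mul]
  linarith

theorem integrable_normalized_adaGradNorm (hg : Measurable (Function.uncurry g)) (hv : 0 < v₀)
    (hξ : ∀ t, Measurable (ξ t)) (t : ℕ) :
    Integrable (fun ω => ‖g (adaGradNorm g x₀ η v₀ (fun k => ξ k ω) t).1 (ξ t ω)‖ ^ 2
        / ((adaGradNorm g x₀ η v₀ (fun k => ξ k ω) t).2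
          + ‖g (adaGradNorm g x₀ η v₀ (fun k => ξ k ω) t).1 (ξ t ω)‖ ^ 2)) P := by
  have hs := measurable_adaGradNorm (x₀ := x₀) (η := η) (v₀ := v₀) hg t fun s _ => hξ s
  have hm : Measurable fun ω => ‖g (adaGradNorm g x₀ η v₀ (fun k => ξ k ω) t).1 (ξ t ω)‖ ^ 2 :=
    (hg.comp (hs.fst.prodMk (hξ t))).norm.pow_const 2
  refine Integrable.of_bound (hm.div (hs.snd.add hm)).aestronglyMeasurable 1
    (ae_of_all _ fun ω => ?_)
  have hw := adaGradNorm_snd_pos (g := g) (x₀ := x₀) (η := η) (z := fun k => ξ k ω) hv t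
  rw [Real.norm_of_nonneg (by positivity)]
  exact div_le_one_of_le₀ (by linarith) (by positivity)

theorem integrable_gradient_adaGradNorm_sq_div (hg : Measurable (Function.uncurry g))
    (hf : IsSmooth f ℓ) (hℓ : 0 ≤ ℓ) (hη : 0 ≤ η) (hv : 0 < v₀) (hξ : ∀ t, Measurable (ξ t))
    (t : ℕ) :
    Integrable (fun ω => ‖gradient f (adaGradNorm g x₀ η v₀ (fun k => ξ k ω) t).1‖ ^ 2
      / √((adaGradNorm g x₀ η v₀ (fun k => ξ k ω) t).2
        + ‖gradient f (adaGradNorm g x₀ η v₀ (fun k => ξ k ω) t).1‖ ^ 2 + σ ^ 2)) P := by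
  have hs := measurable_adaGradNorm (x₀ := x₀) (η := η) (v₀ := v₀) hg t fun s _ => hξ s
  have ha : Measurable fun ω => ‖gradient f (adaGradNorm g x₀ η v₀ (fun k => ξ k ω) t).1‖ ^ 2 :=
    (hf.continuous_gradient.measurable.comp hs.fst).norm.pow_const 2
  refine Integrable.of_bound (ha.div ((hs.snd.add ha).add_const (σ ^ 2)).sqrt).aestronglyMeasurable
    (‖gradient f x₀‖ + ℓ * (η * t)) (ae_of_all _ fun ω => ?_)
  have hw := adaGradNorm_snd_pos (g := g) (x₀ := x₀) (η := η) (z := fun k => ξ k ω) hv t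
  have hb := hf.norm_gradient_adaGradNorm_le (g := g) (x₀ := x₀) hℓ hη hv (fun k => ξ k ω) t
  set a := gradient f (adaGradNorm g x₀ η v₀ (fun k => ξ k ω) t).1
  set w := (adaGradNorm g x₀ η v₀ (fun k => ξ k ω) t).2
  have h0 : 0 < √(w + ‖a‖ ^ 2 + σ ^ 2) := Real.sqrt_pos.2 (by positivity)
  have h1 : ‖a‖ ≤ √(w + ‖a‖ ^ 2 + σ ^ 2) := Real.le_sqrt_of_sq_le (by nlinarith)
  rw [Real.norm_of_nonneg (by positivity), div_le_iff₀ h0]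
  nlinarith [norm_nonneg a]

theorem integrable_comp_adaGradNorm (hg : Measurable (Function.uncurry g)) (hf : Continuous f)
    (hη : 0 ≤ η) (hv : 0 < v₀) (hξ : ∀ t, Measurable (ξ t)) (t : ℕ) :
    Integrable (fun ω => f (adaGradNorm g x₀ η v₀ (fun k => ξ k ω) t).1) P := by
  obtain ⟨K, hK⟩ := exists_abs_adaGradNorm_le (g := g) (x₀ := x₀) (v₀ := v₀) hf hη hv t
  exact Integrable.of_bound (hf.measurable.comp
    (measurable_adaGradNorm hg t fun s _ => hξ s).fst).aestronglyMeasurable K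
    (ae_of_all _ fun ω => hK _)

theorem IsStochasticGradient.integral_step_nonneg_of_indepFun [IsProbabilityMeasure D]
    (hg : IsStochasticGradient f g D σ) (hf : IsSmooth f ℓ) (hσ : 0 ≤ σ) (hη : 0 < η)
    {X : Ω → EuclideanSpace ℝ (Fin d)} {W : Ω → ℝ} {Y : Ω → Ξ} (hXW : Measurable fun ω => (X ω, W ω))
    (hY : Measurable Y) (hYD : P.map Y = D) (hind : IndepFun (fun ω => (X ω, W ω)) Y P)
    (hW : ∀ ω, 0 < W ω)
    (hi : Integrable (fun ω =>
      (f (X ω) - f (X ω - (η / √(W ω + ‖g (X ω) (Y ω)‖ ^ 2)) • g (X ω) (Y ω))) / η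
      + (2 * σ + ℓ * η / 2) * (‖g (X ω) (Y ω)‖ ^ 2 / (W ω + ‖g (X ω) (Y ω)‖ ^ 2))
      - ‖gradient f (X ω)‖ ^ 2 / √(W ω + ‖gradient f (X ω)‖ ^ 2 + σ ^ 2) / 2) P) :
    0 ≤ ∫ ω, ((f (X ω) - f (X ω - (η / √(W ω + ‖g (X ω) (Y ω)‖ ^ 2)) • g (X ω) (Y ω))) / η
      + (2 * σ + ℓ * η / 2) * (‖g (X ω) (Y ω)‖ ^ 2 / (W ω + ‖g (X ω) (Y ω)‖ ^ 2))
      - ‖gradient f (X ω)‖ ^ 2 / √(W ω + ‖gradient f (X ω)‖ ^ 2 + σ ^ 2) / 2) ∂P := by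
  have hfc : Continuous f := hf.1.continuous
  have hmx : Measurable fun p : (EuclideanSpace ℝ (Fin d) × ℝ) × Ξ => p.1.1 := measurable_fst.fst
  have hmw : Measurable fun p : (EuclideanSpace ℝ (Fin d) × ℝ) × Ξ => p.1.2 := measurable_fst.snd
  have hmg : Measurable fun p : (EuclideanSpace ℝ (Fin d) × ℝ) × Ξ => g p.1.1 p.2 :=
    hg.measurable.comp (hmx.prodMk measurable_snd)
  have hmg2 := hmg.norm.pow_const 2
  have hma : Measurable fun p : (EuclideanSpace ℝ (Fin d) × ℝ) × Ξ => ‖gradient f p.1.1‖ ^ 2 :=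
    (hf.continuous_gradient.measurable.comp hmx).norm.pow_const 2
  have hF : Measurable fun p : (EuclideanSpace ℝ (Fin d) × ℝ) × Ξ =>
      (f p.1.1 - f (p.1.1 - (η / √(p.1.2 + ‖g p.1.1 p.2‖ ^ 2)) • g p.1.1 p.2)) / η
      + (2 * σ + ℓ * η / 2) * (‖g p.1.1 p.2‖ ^ 2 / (p.1.2 + ‖g p.1.1 p.2‖ ^ 2))
      - ‖gradient f p.1.1‖ ^ 2 / √(p.1.2 + ‖gradient f p.1.1‖ ^ 2 + σ ^ 2) / 2 := by
    refine ((((hfc.measurable.comp hmx).sub (hfc.measurable.comp (hmx.sub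
      ((measurable_const.div (hmw.add hmg2).sqrt).smul hmg)))).div_const η).add
      ((hmg2.div (hmw.add hmg2)).const_mul _)).sub ?_
    exact (hma.div ((hmw.add hma).add_const (σ ^ 2)).sqrt).div_const 2
  rw [hind.integral_comp_prodMk hXW hY hF hi, hYD]
  exact integral_nonneg fun ω => hg.integral_step_nonneg hf hσ hη (X ω) (hW ω)

theorem IsStochasticGradient.integral_step_adaGradNorm_le [IsProbabilityMeasure D]
    (hg : IsStochasticGradient f g D σ) (hf : IsSmooth f ℓ) (hℓ : 0 ≤ ℓ) (hσ : 0 ≤ σ) (hη : 0 < η)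
    (hv : 0 < v₀) (hξ : ∀ t, Measurable (ξ t)) (hD : ∀ t, P.map (ξ t) = D)
    (hind : iIndepFun ξ P) (t : ℕ) :
    ∫ ω, ‖gradient f (adaGradNorm g x₀ η v₀ (fun k => ξ k ω) t).1‖ ^ 2
      / √((adaGradNorm g x₀ η v₀ (fun k => ξ k ω) t).2
        + ‖gradient f (adaGradNorm g x₀ η v₀ (fun k => ξ k ω) t).1‖ ^ 2 + σ ^ 2) ∂P ≤
      2 * ((∫ ω, f (adaGradNorm g x₀ η v₀ (fun k => ξ k ω) t).1 ∂P
        - ∫ ω, f (adaGradNorm g x₀ η v₀ (fun k => ξ k ω) (t + 1)).1 ∂P) / η)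
      + (4 * σ + ℓ * η) *
        ∫ ω, ‖g (adaGradNorm g x₀ η v₀ (fun k => ξ k ω) t).1 (ξ t ω)‖ ^ 2
        / ((adaGradNorm g x₀ η v₀ (fun k => ξ k ω) t).2
          + ‖g (adaGradNorm g x₀ η v₀ (fun k => ξ k ω) t).1 (ξ t ω)‖ ^ 2) ∂P := by
  have hfc : Continuous f := hf.1.continuous
  have hF0 := integrable_comp_adaGradNorm (P := P) (x₀ := x₀) hg.measurable hfc hη.le hv hξ t
  have hF1 := integrable_comp_adaGradNorm (P := P) (x₀ := x₀) hg.measurable hfc hη.le hv hξ (t + 1)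
  have hr := integrable_normalized_adaGradNorm (P := P) (x₀ := x₀) (η := η) hg.measurable hv hξ t
  have ha := integrable_gradient_adaGradNorm_sq_div (P := P) (x₀ := x₀) (σ := σ) hg.measurable
    hf hℓ hη.le hv hξ t
  have hI1 := (hF0.sub hF1).div_const η
  have hI2 := hr.const_mul (2 * σ + ℓ * η / 2)
  have hI3 := ha.div_const 2
  simp only [Pi.sub_def] at hI1
  have hI12 := hI1.add hI2
  simp only [Pi.add_def] at hI12
  have key := hg.integral_step_nonneg_of_indepFun hf hσ hη
    (X := fun ω => (adaGradNorm g x₀ η v₀ (fun k => ξ k ω) t).1)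
    (W := fun ω => (adaGradNorm g x₀ η v₀ (fun k => ξ k ω) t).2)
    (measurable_adaGradNorm hg.measurable t fun s _ => hξ s) (hξ t) (hD t)
    (indepFun_adaGradNorm hg.measurable hξ hind t) (fun ω => adaGradNorm_snd_pos hv t)
  simp_rw [← adaGradNorm_succ_fst] at key
  replace key := key (hI12.sub hI3)
  rw [integral_sub hI12 hI3, integral_add hI1 hI2] at key
  rw [integral_const_mul, integral_div, integral_div] at key
  rw [integral_sub hF0 hF1] at key
  linarith

end Run

/-! ### Summation over the run and the final rate. -/

section Rate

variable {d : ℕ} {f : EuclideanSpace ℝ (Fin d) → ℝ} {ℓ σ Δ η v₀ : ℝ} {Ξ : Type*}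
  {g : EuclideanSpace ℝ (Fin d) → Ξ → EuclideanSpace ℝ (Fin d)} {x₀ : EuclideanSpace ℝ (Fin d)}
  [MeasurableSpace Ξ] {D : Measure Ξ}
  {Ω : Type*} [MeasurableSpace Ω] {P : Measure Ω} [IsProbabilityMeasure P] {ξ : ℕ → Ω → Ξ}

/-- With `b = B / v₀` and `τ = T`, the left side bounds `E v_T² / v₀²`; the exponent `6` becomes the
factor in front of the logarithm. -/
theorem one_add_four_mul_sq_mul_cube_le {b τ : ℝ} (hb : 0 ≤ b) (hτ : 1 ≤ τ) :
    1 + 4 * b ^ 2 * τ ^ 3 ≤ (2 + τ + b) ^ 6 := by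
  have hτ0 : 0 ≤ τ := by linarith
  have h1 : 4 * τ ^ 3 + 1 ≤ (2 + τ + b) ^ 4 := by
    calc 4 * τ ^ 3 + 1 ≤ (2 + τ) ^ 4 := by
          have : 0 ≤ τ ^ 4 := by positivity
          have : 0 ≤ τ ^ 3 := by positivity
          nlinarith
      _ ≤ _ := pow_le_pow_left₀ (by positivity) (by linarith) 4
  have h2 : b ^ 2 + 1 ≤ (2 + τ + b) ^ 2 := by nlinarith
  calc 1 + 4 * b ^ 2 * τ ^ 3 ≤ (4 * τ ^ 3 + 1) * (b ^ 2 + 1) := by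
        have : 0 ≤ τ ^ 3 := by positivity
        nlinarith [sq_nonneg b]
    _ ≤ (2 + τ + b) ^ 4 * (2 + τ + b) ^ 2 := by gcongr
    _ = _ := by ring

theorem IsStochasticGradient.sum_integral_normalized_le [IsProbabilityMeasure D]
    (hg : IsStochasticGradient f g D σ) (hf : IsSmooth f ℓ) (hℓ : 0 < ℓ) (hσ : 0 ≤ σ)
    (hη : 0 < η) (hv : 0 < v₀) (hΔ : ∀ x, f x₀ - f x ≤ Δ) (hξ : ∀ t, Measurable (ξ t))
    (hD : ∀ t, P.map (ξ t) = D) (hind : iIndepFun ξ P) {T : ℕ} (hT : 1 ≤ T) :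
    ∑ t ∈ Finset.range T,
      ∫ ω, ‖g (adaGradNorm g x₀ η v₀ (fun k => ξ k ω) t).1 (ξ t ω)‖ ^ 2
        / ((adaGradNorm g x₀ η v₀ (fun k => ξ k ω) t).2
          + ‖g (adaGradNorm g x₀ η v₀ (fun k => ξ k ω) t).1 (ξ t ω)‖ ^ 2) ∂P
      ≤ 6 * Real.log (2 + T + (Δ / η + σ + ℓ * η) / v₀) := by
  have hT1 : (1 : ℝ) ≤ T := by exact_mod_cast hT
  have hΔ0 : 0 ≤ Δ := by simpa using hΔ x₀
  set B := Δ / η + σ + ℓ * η with hB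
  have hΔη : 0 ≤ Δ / η := by positivity
  have hℓη : 0 < ℓ * η := by positivity
  have hB0 : 0 < B := by positivity
  -- The step size cancels in `2ℓΔ = 2 (Δ/η)(ℓη)`, which is at most `B²`.
  have hG0 : ‖gradient f x₀‖ ≤ B := by
    refine abs_le_of_sq_le_sq' ?_ hB0.le |>.2
    have h1 := hf.norm_gradient_sq_le hℓ hΔ
    have h2 : 2 * ℓ * Δ = 2 * (Δ / η) * (ℓ * η) := by field_simp
    nlinarith [mul_nonneg hΔη hσ, mul_nonneg hℓη.le hσ]
  have hgi := fun t => hg.integrable_norm_sq_adaGradNorm (x₀ := x₀) hf hℓ.le hη.le hv hξ hD hind t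
  have hri := fun t => integrable_normalized_adaGradNorm (P := P) (x₀ := x₀) (η := η)
    hg.measurable hv hξ t
  have hgle : ∀ t ∈ Finset.range T,
      ∫ ω, ‖g (adaGradNorm g x₀ η v₀ (fun k => ξ k ω) t).1 (ξ t ω)‖ ^ 2 ∂P
        ≤ 4 * (B ^ 2 * (T : ℝ) ^ 2) := by
    intro t ht
    refine (hgi t).2.trans ?_
    have ht' : (t : ℝ) + 1 ≤ T := by exact_mod_cast Finset.mem_range.1 ht
    have hℓηB : ℓ * η ≤ B := by linarith
    have h1 : ‖gradient f x₀‖ + ℓ * (η * t) ≤ B * T := by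
      have : ℓ * (η * t) ≤ B * t := by rw [← mul_assoc]; gcongr
      nlinarith
    have h2 : (‖gradient f x₀‖ + ℓ * (η * t)) ^ 2 ≤ (B * T) ^ 2 := by gcongr
    have h3 : σ ≤ B * T := by nlinarith
    have h4 : σ ^ 2 ≤ (B * T) ^ 2 := by gcongr
    rw [mul_pow] at h2 h4
    linarith
  have hwi : Integrable (fun ω => (adaGradNorm g x₀ η v₀ (fun k => ξ k ω) T).2) P := by
    simp_rw [adaGradNorm_snd_eq_sum]
    exact (integrable_const _).add (integrable_finsetSum _ fun t _ => (hgi t).1)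
  have hw : ∫ ω, (adaGradNorm g x₀ η v₀ (fun k => ξ k ω) T).2 ∂P
      ≤ v₀ ^ 2 + 4 * (B ^ 2 * (T : ℝ) ^ 3) := by
    simp_rw [adaGradNorm_snd_eq_sum]
    rw [integral_add (integrable_const _) (integrable_finsetSum _ fun t _ => (hgi t).1),
      integral_finsetSum _ fun t _ => (hgi t).1, integral_const, probReal_univ, one_smul]
    have h := Finset.sum_le_sum hgle
    rw [Finset.sum_const, Finset.card_range, nsmul_eq_mul] at h
    linarith
  set q := 2 + T + B / v₀ with hq
  have hq0 : 0 < q := by positivity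
  have hwq : (∫ ω, (adaGradNorm g x₀ η v₀ (fun k => ξ k ω) T).2 ∂P) / v₀ ^ 2 / q ^ 6 ≤ 1 := by
    refine div_le_one_of_le₀ ?_ (by positivity)
    refine le_trans ?_ (one_add_four_mul_sq_mul_cube_le (b := B / v₀) (by positivity) hT1)
    rw [div_le_iff₀ (by positivity)]
    refine hw.trans (le_of_eq ?_)
    field_simp
  have hpt : ∀ ω, ∑ t ∈ Finset.range T,
      ‖g (adaGradNorm g x₀ η v₀ (fun k => ξ k ω) t).1 (ξ t ω)‖ ^ 2
        / ((adaGradNorm g x₀ η v₀ (fun k => ξ k ω) t).2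
          + ‖g (adaGradNorm g x₀ η v₀ (fun k => ξ k ω) t).1 (ξ t ω)‖ ^ 2)
      ≤ 6 * Real.log q - 1
        + (adaGradNorm g x₀ η v₀ (fun k => ξ k ω) T).2 / v₀ ^ 2 / q ^ 6 := by
    intro ω
    refine (sum_normalized_le_log (η := η) (z := fun k => ξ k ω) hv T).trans ?_
    have hw0 := adaGradNorm_snd_pos (g := g) (x₀ := x₀) (η := η) (z := fun k => ξ k ω) hv T
    have hy : 0 < (adaGradNorm g x₀ η v₀ (fun k => ξ k ω) T).2 / v₀ ^ 2 := by positivity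
    -- Jensen for the logarithm through its tangent at `q ^ 6`: the resulting bound is affine in
    -- `v_T²`, so the logarithm itself is never integrated.
    have h := Real.log_le_sub_one_of_pos (div_pos hy (pow_pos hq0 6))
    rw [Real.log_div hy.ne' (by positivity), Real.log_pow] at h
    push_cast at h
    linarith
  have hyi := (hwi.div_const (v₀ ^ 2)).div_const (q ^ 6)
  rw [← integral_finsetSum _ fun t _ => hri t]
  refine (integral_mono (integrable_finsetSum _ fun t _ => hri t)
    ((integrable_const (6 * Real.log q - 1)).add hyi) hpt).trans ?_
  rw [integral_add' (integrable_const _) hyi, integral_div, integral_div, integral_const,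
    probReal_univ, one_smul]
  linarith

theorem IsStochasticGradient.sum_integral_gradient_sq_div_le [IsProbabilityMeasure D]
    (hg : IsStochasticGradient f g D σ) (hf : IsSmooth f ℓ) (hℓ : 0 < ℓ) (hσ : 0 ≤ σ)
    (hη : 0 < η) (hv : 0 < v₀) (hΔ : ∀ x, f x₀ - f x ≤ Δ) (hξ : ∀ t, Measurable (ξ t))
    (hD : ∀ t, P.map (ξ t) = D) (hind : iIndepFun ξ P) {T : ℕ} (hT : 1 ≤ T) :
    ∑ t ∈ Finset.range T,
      ∫ ω, ‖gradient f (adaGradNorm g x₀ η v₀ (fun k => ξ k ω) t).1‖ ^ 2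
      / √((adaGradNorm g x₀ η v₀ (fun k => ξ k ω) t).2
        + ‖gradient f (adaGradNorm g x₀ η v₀ (fun k => ξ k ω) t).1‖ ^ 2 + σ ^ 2) ∂P
      ≤ 26 * (Δ / η + σ + ℓ * η) * Real.log (2 + T + (Δ / η + σ + ℓ * η) / v₀) := by
  have hT1 : (1 : ℝ) ≤ T := by exact_mod_cast hT
  have hΔ0 : 0 ≤ Δ := by simpa using hΔ x₀
  have hΔη : 0 ≤ Δ / η := by positivity
  have hℓη : 0 < ℓ * η := by positivity
  have hr := hg.sum_integral_normalized_le hf hℓ hσ hη hv hΔ hξ hD hind hT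
  -- The argument is at least `3 > e`; this lets the `Δ / η` term, which comes without a logarithm,
  -- be absorbed.
  have hlog : 1 ≤ Real.log (2 + T + (Δ / η + σ + ℓ * η) / v₀) := by
    rw [Real.le_log_iff_exp_le (by positivity)]
    have h1 : 0 ≤ (Δ / η + σ + ℓ * η) / v₀ := by positivity
    linarith [Real.exp_one_lt_d9]
  refine (Finset.sum_le_sum fun t _ =>
    hg.integral_step_adaGradNorm_le (x₀ := x₀) hf hℓ.le hσ hη hv hξ hD hind t).trans ?_
  rw [Finset.sum_add_distrib, ← Finset.mul_sum, ← Finset.mul_sum, ← Finset.sum_div,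
    Finset.sum_range_sub' (fun t => ∫ ω, f (adaGradNorm g x₀ η v₀ (fun k => ξ k ω) t).1 ∂P)]
  have hdrop : ∫ ω, f (adaGradNorm g x₀ η v₀ (fun k => ξ k ω) 0).1 ∂P
      - ∫ ω, f (adaGradNorm g x₀ η v₀ (fun k => ξ k ω) T).1 ∂P ≤ Δ := by
    have hi := fun t => integrable_comp_adaGradNorm (P := P) (x₀ := x₀) hg.measurable
      hf.1.continuous hη.le hv hξ t
    rw [← integral_sub (hi 0) (hi T)]
    refine (integral_mono ((hi 0).sub (hi T)) (integrable_const Δ) fun ω => hΔ _).trans ?_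
    simp
  have h1 := div_le_div_of_nonneg_right hdrop hη.le
  have h2 := mul_le_mul_of_nonneg_left hr (show 0 ≤ 4 * σ + ℓ * η by positivity)
  set Λ := Real.log (2 + T + (Δ / η + σ + ℓ * η) / v₀)
  -- The coefficients of `Δ/η`, `σ` and `ℓη` against `Λ` are `2`, `24` and `6`, all below `26`.
  nlinarith [mul_le_mul_of_nonneg_left hlog hΔη, mul_nonneg hΔη (zero_le_one.trans hlog),
    mul_nonneg hσ (zero_le_one.trans hlog), mul_nonneg hℓη.le (zero_le_one.trans hlog)]

end Rate

theorem proposition4 :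
    ∃ C : ℝ, 0 < C ∧
      ∀ (d : ℕ) (f : EuclideanSpace ℝ (Fin d) → ℝ) (ℓ σ Δ : ℝ)
        (Ξ : Type*) [MeasurableSpace Ξ] (D : Measure Ξ) [IsProbabilityMeasure D]
        (g : EuclideanSpace ℝ (Fin d) → Ξ → EuclideanSpace ℝ (Fin d))
        (x₀ : EuclideanSpace ℝ (Fin d))
        (Ω : Type*) [MeasurableSpace Ω] (P : Measure Ω) [IsProbabilityMeasure P]
        (ξ : ℕ → Ω → Ξ) (η v₀ : ℝ) (T : ℕ),
        0 < ℓ → IsSmooth f ℓ →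
        0 ≤ σ → IsStochasticGradient f g D σ →
        (∀ x, f x₀ - f x ≤ Δ) →
        (∀ t, Measurable (ξ t)) → (∀ t, P.map (ξ t) = D) → iIndepFun ξ P →
        0 < η → 0 < v₀ → 1 ≤ T →
        ∀ A : ℝ,
          A = C * (Δ / η + σ + ℓ * η) * Real.log (2 + T + (Δ / η + σ + ℓ * η) / v₀) →
          (∀ t, Integrable
            (fun ω => ‖gradient f (adaGradNorm g x₀ η v₀ (fun k => ξ k ω) t).1‖) P) ∧
          (1 / (T : ℝ)) * ∑ t ∈ Finset.range T,
              ∫ ω, ‖gradient f (adaGradNorm g x₀ η v₀ (fun k => ξ k ω) t).1‖ ∂P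
            ≤ 2 * A / √(T : ℝ) + √(v₀ * A) / √(T : ℝ)
              + 2 * √(A * σ) / (T : ℝ) ^ (1 / 4 : ℝ) := by
  refine ⟨26, by norm_num, ?_⟩
  intro d f ℓ σ Δ Ξ _ D _ g x₀ Ω _ P _ ξ η v₀ T hℓ hf hσ hg hΔ hξ hD hind hη hv hT A hA
  have hΔ0 : 0 ≤ Δ := by simpa using hΔ x₀
  have hm : ∀ t, Measurable fun ω =>
      ‖gradient f (adaGradNorm g x₀ η v₀ (fun k => ξ k ω) t).1‖ := fun t =>
    (hf.continuous_gradient.measurable.comp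
      (measurable_adaGradNorm hg.measurable t fun s _ => hξ s).fst).norm
  have hb : ∀ t ω, ‖gradient f (adaGradNorm g x₀ η v₀ (fun k => ξ k ω) t).1‖
      ≤ ‖gradient f x₀‖ + ℓ * (η * t) := fun t ω =>
    hf.norm_gradient_adaGradNorm_le hℓ.le hη.le hv _ t
  have hi : ∀ t, Integrable (fun ω =>
      ‖gradient f (adaGradNorm g x₀ η v₀ (fun k => ξ k ω) t).1‖) P := fun t =>
    Integrable.of_bound (hm t).aestronglyMeasurable _
      (ae_of_all _ fun ω => (norm_norm _).trans_le (hb t ω))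
  have hi2 : ∀ t, Integrable (fun ω =>
      ‖gradient f (adaGradNorm g x₀ η v₀ (fun k => ξ k ω) t).1‖ ^ 2) P := fun t =>
    Integrable.of_bound ((hm t).pow_const 2).aestronglyMeasurable
      ((‖gradient f x₀‖ + ℓ * (η * t)) ^ 2) (ae_of_all _ fun ω => by
        rw [norm_pow, norm_norm]
        exact pow_le_pow_left₀ (norm_nonneg _) (hb t ω) 2)
  have hnoise := fun t =>
    hg.noise_adaGradNorm (x₀ := x₀) (η := η) (v₀ := v₀) hf hξ hD hind t
  have hA0 : 0 < A := by
    have hB : 0 < Δ / η + σ + ℓ * η := by positivity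
    rw [hA]
    refine mul_pos (by positivity) (Real.log_pos ?_)
    have : 0 ≤ (T : ℝ) + (Δ / η + σ + ℓ * η) / v₀ := by positivity
    linarith
  refine ⟨hi, average_integral_le hv hσ hA0 hT
    (fun t ω => adaGradNorm_snd_pos (g := g) (x₀ := x₀) (η := η) (z := fun k => ξ k ω) hv t)
    (fun t ω => ?_) hi hi2 (fun t => (hnoise t).1) (fun t => (hnoise t).2)
    (fun t => integrable_gradient_adaGradNorm_sq_div hg.measurable hf hℓ.le hη.le hv hξ t)
    (hA ▸ hg.sum_integral_gradient_sq_div_le hf hℓ hσ hη hv hΔ hξ hD hind hT)⟩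
  rw [adaGradNorm_snd_eq_sum]
  gcongr
  exact norm_sq_le_two_mul_add _ _
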